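/- Let $\Lambda$ be an Artin algebra, i.e. an algebra over a commutative Artinian ring $k$ that is finitely generated as a $k$-module. All modules are finitely generated left $\Lambda$-modules. Call a module $M$ self-orthogonal if $\operatorname{Ext}^i_\Lambda(M,M)=0$ for all $i\ge 1$. Let $\mathscr C$ be the class of modules $M$ with $\operatorname{Ext}^i_\Lambda(M,\Lambda)=0$ for all $i\ge 1$. Let $\mathscr D$ be the class of Gorenstein projective modules, i.e. of the modules $M$ with $\operatorname{Ext}^i_\Lambda(M,\Lambda)=0$ and $\operatorname{Ext}^i_{\Lambda^{op}}(\operatorname{Tr}M,\Lambda)=0$ for all $i\ge 1$; here the Auslander transpose $\operatorname{Tr}M$ is the cokernel of $\operatorname{Hom}_\Lambda(P_0,\Lambda)\to\operatorname{Hom}_\Lambda(P_1,\Lambda)$ for a minimal projective presentation $P_1\to P_0\to M\to 0$. Proposition 3.5. (a) If there are only finitely many isomorphism classes of self-orthogonal indecomposable modules in $\mathscr D$, then every self-orthogonal indecomposable module in $\mathscr D$ is projective. (b) If there are only finitely many isomorphism classes of self-orthogonal indecomposable modules in $\mathscr C$, then every self-orthogonal indecomposable module in $\mathscr C$ is projective.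 -/

import Mathlib

open CategoryTheory

universe u

/-- A linear map is an essential epimorphism if it is surjective and its
kernel is a superfluous submodule.  With projective source, this is a projective cover. -/
structure IsEssentialEpi {R : Type u} [Ring R] {P M : Type u} [AddCommGroup P] [Module R P]
    [AddCommGroup M] [Module R M] (f : P →ₗ[R] M) : Prop where
  surjective : Function.Surjective f
  superfluous : ∀ N : Submodule R P, N ⊔ LinearMap.ker f = ⊤ → N = ⊤

/-- `P₁ --g--> P₀ --f--> M --> 0` is a minimal projective presentation: it is exact, `P₀` and `P₁`
are finitely generated projective, `f` is a projective cover of `M`, and `g` is (after restricting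
its codomain to `ker f = range g`) a projective cover of the first syzygy `ker f`. -/
structure IsMinimalProjectivePresentation {R : Type u} [Ring R] {P₁ P₀ M : Type u}
    [AddCommGroup P₁] [Module R P₁] [AddCommGroup P₀] [Module R P₀] [AddCommGroup M] [Module R M]
    (g : P₁ →ₗ[R] P₀) (f : P₀ →ₗ[R] M) : Prop where
  finite₁ : Module.Finite R P₁
  projective₁ : Module.Projective R P₁
  finite₀ : Module.Finite R P₀
  projective₀ : Module.Projective R P₀
  exact : LinearMap.range g = LinearMap.ker f
  cover₀ : IsEssentialEpi f
  cover₁ : IsEssentialEpi g.rangeRestrict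

/-- For `g : P₁ → P₀`, the map `g^* : Hom_R(P₀, R) → Hom_R(P₁, R)`, `φ ↦ φ ∘ g`, of right
`R`-modules (i.e. left modules over the opposite ring). -/
def dualMapOp {R : Type u} [Ring R] {P₁ P₀ : Type u}
    [AddCommGroup P₁] [Module R P₁] [AddCommGroup P₀] [Module R P₀] (g : P₁ →ₗ[R] P₀) :
    (P₀ →ₗ[R] R) →ₗ[Rᵐᵒᵖ] (P₁ →ₗ[R] R) :=
  LinearMap.lcomp Rᵐᵒᵖ R g

/-- The right module `T` is (isomorphic to) the Auslander transpose `Tr M`: the cokernel of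
`g^* : P₀^* → P₁^*` for a minimal projective presentation `P₁ --g--> P₀ --> M --> 0`. -/
def IsAuslanderTranspose {R : Type u} [Ring R] (M : ModuleCat.{u} R) (T : ModuleCat.{u} Rᵐᵒᵖ) :
    Prop :=
  ∃ (P₁ P₀ : ModuleCat.{u} R) (g : P₁ →ₗ[R] P₀) (f : P₀ →ₗ[R] M),
    IsMinimalProjectivePresentation g f ∧
    Nonempty (T ≃ₗ[Rᵐᵒᵖ] ((P₁ →ₗ[R] R) ⧸ LinearMap.range (dualMapOp g)))

/-- The class `𝒞`: finitely generated left modules `M` with `Ext^i(M, R) = 0` for all `i ≥ 1`. -/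
structure IsInC {R : Type u} [Ring R] (M : ModuleCat.{u} R) : Prop where
  finite : Module.Finite R M
  ext_eq_zero : ∀ i : ℕ, 1 ≤ i → Subsingleton (Abelian.Ext.{u} M (ModuleCat.of R R) i)

/-- The class `𝒟` of (finitely generated) Gorenstein projective left modules: those `M` such that
`Ext^i_R(M, R) = 0` and `Ext^i_{R^op}(Tr M, R) = 0` for all `i ≥ 1`. -/
structure IsGorensteinProjective {R : Type u} [Ring R] (M : ModuleCat.{u} R) : Prop where
  finite : Module.Finite R M
  ext_eq_zero : ∀ i : ℕ, 1 ≤ i → Subsingleton (Abelian.Ext.{u} M (ModuleCat.of R R) i)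
  ext_transpose_eq_zero : ∃ T : ModuleCat.{u} Rᵐᵒᵖ, IsAuslanderTranspose M T ∧
    ∀ i : ℕ, 1 ≤ i → Subsingleton (Abelian.Ext.{u} T (ModuleCat.of Rᵐᵒᵖ R) i)

/-- `M` is self-orthogonal: `Ext^i(M, M) = 0` for all `i ≥ 1`. -/
def IsSelfOrthogonal {R : Type u} [Ring R] (M : ModuleCat.{u} R) : Prop :=
  ∀ i : ℕ, 1 ≤ i → Subsingleton (Abelian.Ext.{u} M M i)

/-- There are only finitely many isomorphism classes of modules satisfying `P`. -/
def FinitelyManyIsoclasses {R : Type u} [Ring R] (P : ModuleCat.{u} R → Prop) : Prop :=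
  ((fun M : ModuleCat.{u} R => Quotient.mk (isIsomorphicSetoid (ModuleCat.{u} R)) M) ''
    {M | P M}).Finite

/-! Suppose `M` is a non-projective self-orthogonal indecomposable in the class, and let `ΩM` be the
kernel of a projective cover `P → M`. Then `ΩM` has the same properties
(`ker_isSelfOrthogonal_indecomposable_not_projective`), so syzygies can be iterated forever. Since
there are finitely many isoclasses, `Ω^i M ≅ Ω^j M` for some `i < j`. Dimension shifting from the
self-orthogonality of `Ω^i M` gives `Ext^1(Ω^(j-1) M, Ω^i M) = 0`, hence `Ext^1(Ω^(j-1) M, Ω^j M) =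
0`. The sequence `0 → Ω^j M → P' → Ω^(j-1) M → 0` therefore splits and `Ω^(j-1) M` is projective, a
contradiction.

Heredity of the properties rests on `Ext^i(M, Q) = 0` for finitely generated projective `Q` and `i ≥
1`. Indecomposability comes from Fitting's lemma (`IsEssentialEpi.idempotent_ker_trivial`), and the
transpose condition from an exact sequence linking `Tr M` and `Tr ΩM` (`transpose_syzygy`). -/

/-! ### Dimension shifting and splitting from vanishing Ext. -/

section ExtDimensionShifting

universe w v

variable {C : Type*} [Category.{v} C] [Abelian C] [HasExt.{w} C] {S : ShortComplex C}

open Abelian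

theorem Ext_subsingleton_of_iso {X X' : C} (e : X ≅ X') (Y : C) (n : ℕ)
    [Subsingleton (Ext.{w} X Y n)] : Subsingleton (Ext.{w} X' Y n) := by
  refine subsingleton_of_forall_eq 0 fun x => ?_
  rw [← Ext.mk₀_id_comp x, ← e.inv_hom_id, ← Ext.mk₀_comp_mk₀_assoc,
    Subsingleton.elim ((Ext.mk₀ e.hom).comp x (zero_add n)) 0, Ext.comp_zero]

theorem Ext_subsingleton_of_iso_right (X : C) {Y Y' : C} (e : Y ≅ Y') (n : ℕ)
    [Subsingleton (Ext.{w} X Y n)] : Subsingleton (Ext.{w} X Y' n) := by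
  refine subsingleton_of_forall_eq 0 fun x => ?_
  rw [← Ext.comp_mk₀_id x, ← e.inv_hom_id, ← Ext.mk₀_comp_mk₀,
    ← Ext.comp_assoc_of_second_deg_zero,
    Subsingleton.elim (x.comp (Ext.mk₀ e.inv) (add_zero n)) 0, Ext.zero_comp]

theorem Ext_subsingleton_X₁ (hS : S.ShortExact) [Projective S.X₂] (Y : C) (n : ℕ)
    [Subsingleton (Ext.{w} S.X₃ Y (n + 2))] : Subsingleton (Ext.{w} S.X₁ Y (n + 1)) := by
  refine subsingleton_of_forall_eq 0 fun x => ?_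
  obtain ⟨y, rfl⟩ := Ext.contravariant_sequence_exact₁ hS Y x (n₁ := n + 2) (by omega)
    (Subsingleton.elim _ _)
  rw [Ext.eq_zero_of_projective y, Ext.comp_zero]

theorem Ext_subsingleton_X₃ (hS : S.ShortExact) [Projective S.X₂] (Y : C) (n : ℕ)
    [Subsingleton (Ext.{w} S.X₁ Y (n + 1))] : Subsingleton (Ext.{w} S.X₃ Y (n + 2)) := by
  refine subsingleton_of_forall_eq 0 fun x => ?_
  obtain ⟨y, rfl⟩ := Ext.contravariant_sequence_exact₃ hS Y x
    (Ext.eq_zero_of_projective (n := n + 1) _) (n₀ := n + 1) (by omega)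
  rw [Subsingleton.elim y 0, Ext.comp_zero]

theorem Ext_subsingleton_right_X₁ (hS : S.ShortExact) (X : C) (n : ℕ)
    [Subsingleton (Ext.{w} X S.X₃ n)] [Subsingleton (Ext.{w} X S.X₂ (n + 1))] :
    Subsingleton (Ext.{w} X S.X₁ (n + 1)) := by
  refine subsingleton_of_forall_eq 0 fun x => ?_
  obtain ⟨y, rfl⟩ := Ext.covariant_sequence_exact₁ X hS x (Subsingleton.elim _ _) rfl
  rw [Subsingleton.elim y 0, Ext.zero_comp]

theorem exists_section_of_Ext_subsingleton (hS : S.ShortExact)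
    [Subsingleton (Ext.{w} S.X₃ S.X₁ 1)] : ∃ s : S.X₃ ⟶ S.X₂, s ≫ S.g = 𝟙 _ := by
  obtain ⟨y, hy⟩ := Ext.covariant_sequence_exact₃ S.X₃ hS (Ext.mk₀ (𝟙 S.X₃)) (zero_add 1)
    (Subsingleton.elim _ _)
  obtain ⟨s, rfl⟩ := (Ext.mk₀_bijective _ _).2 y
  rw [Ext.mk₀_comp_mk₀] at hy
  exact ⟨s, (Ext.mk₀_bijective _ _).1 hy⟩

theorem exists_extension_of_Ext_subsingleton (hS : S.ShortExact) {Y : C}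
    [Subsingleton (Ext.{w} S.X₃ Y 1)] (a : S.X₁ ⟶ Y) : ∃ b : S.X₂ ⟶ Y, S.f ≫ b = a := by
  obtain ⟨y, hy⟩ := Ext.contravariant_sequence_exact₁ hS Y (Ext.mk₀ a) (add_zero 1)
    (Subsingleton.elim _ _)
  obtain ⟨b, rfl⟩ := (Ext.mk₀_bijective _ _).2 y
  rw [Ext.mk₀_comp_mk₀] at hy
  exact ⟨b, (Ext.mk₀_bijective _ _).1 hy⟩

theorem Ext_one_subsingleton_of_exists_extension (hS : S.ShortExact) [Projective S.X₂] {Y : C}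
    (h : ∀ a : S.X₁ ⟶ Y, ∃ b : S.X₂ ⟶ Y, S.f ≫ b = a) : Subsingleton (Ext.{w} S.X₃ Y 1) := by
  refine subsingleton_of_forall_eq 0 fun x => ?_
  obtain ⟨y, rfl⟩ := Ext.contravariant_sequence_exact₃ hS Y x
    (Ext.eq_zero_of_projective (n := 0) _) (n₀ := 0) (by omega)
  obtain ⟨a, rfl⟩ := (Ext.mk₀_bijective _ _).2 y
  obtain ⟨b, rfl⟩ := h a
  rw [← Ext.mk₀_comp_mk₀, hS.extClass_comp_assoc]

end ExtDimensionShifting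

/-! ### Fitting's lemma and indecomposability of syzygies. -/

section Indecomposable

variable {R : Type u} [Ring R]

theorem CategoryTheory.Indecomposable.eq_bot_or_eq_bot_of_isCompl {M : ModuleCat.{u} R} (hM : Indecomposable M)
    {p q : Submodule R M} (hpq : IsCompl p q) : p = ⊥ ∨ q = ⊥ := by
  have := hM.2 (.of R p) (.of R q) ((Submodule.prodEquivOfIsCompl p q hpq).symm.toModuleIso ≪≫
    (ModuleCat.biprodIsoProd (.of R p) (.of R q)).symm)
  refine this.imp (fun h => ?_) (fun h => ?_)
  · exact Submodule.subsingleton_iff_eq_bot.mp (ModuleCat.subsingleton_of_isZero h)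
  · exact Submodule.subsingleton_iff_eq_bot.mp (ModuleCat.subsingleton_of_isZero h)

theorem CategoryTheory.Indecomposable.pow_eq_zero_or_surjective {M : ModuleCat.{u} R} (hM : Indecomposable M)
    [IsArtinian R M] [IsNoetherian R M] (φ : Module.End R M) :
    (∃ n : ℕ, φ ^ (n + 1) = 0) ∨ Function.Surjective φ := by
  obtain ⟨n, hn⟩ := Filter.eventually_atTop.mp φ.eventually_isCompl_ker_pow_range_pow
  rcases hM.eq_bot_or_eq_bot_of_isCompl (hn (n + 1) n.le_succ) with h | h
  · right
    have hinj : Function.Injective φ := by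
      rw [← LinearMap.ker_eq_bot, eq_bot_iff, ← h, pow_succ]
      exact LinearMap.ker_le_ker_comp φ (φ ^ n)
    exact IsArtinian.surjective_of_injective_endomorphism φ hinj
  · exact Or.inl ⟨n, LinearMap.range_eq_bot.mp h⟩

theorem indecomposable_of_idempotents {M : ModuleCat.{u} R} (h0 : ¬ Limits.IsZero M)
    (h : ∀ e : M →ₗ[R] M, (∀ x, e (e x) = e x) → e = 0 ∨ e = LinearMap.id) :
    Indecomposable M := by
  refine ⟨h0, fun Y Z i => ?_⟩
  -- The idempotent projecting onto the summand `Y`.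
  let e : M ⟶ M := i.hom ≫ Limits.biprod.fst ≫ Limits.biprod.inl ≫ i.inv
  have he : e ≫ e = e := by simp [e]
  rcases h e.hom (fun x => congr($he x)) with h | h
  · left
    have : e = 0 := ModuleCat.hom_ext h
    rw [Limits.IsZero.iff_id_eq_zero]
    calc 𝟙 Y = Limits.biprod.inl ≫ i.inv ≫ e ≫ i.hom ≫ Limits.biprod.fst := by simp [e]
      _ = 0 := by simp [this]
  · right
    have : e = 𝟙 M := ModuleCat.hom_ext h
    rw [Limits.IsZero.iff_id_eq_zero]
    calc 𝟙 Z = Limits.biprod.inr ≫ i.inv ≫ 𝟙 M ≫ i.hom ≫ Limits.biprod.snd := by simp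
      _ = 0 := by rw [← this]; simp [e]

theorem exists_linearMap_factor {A B D : Type*} [AddCommGroup A] [Module R A] [AddCommGroup B]
    [Module R B] [AddCommGroup D] [Module R D] {f : A →ₗ[R] B} (hf : Function.Surjective f)
    (g : A →ₗ[R] D) (h : ∀ x, f x = 0 → g x = 0) : ∃ φ : B →ₗ[R] D, ∀ x, φ (f x) = g x := by
  refine ⟨(LinearMap.ker f).liftQ g h ∘ₗ (f.quotKerEquivOfSurjective hf).symm, fun x => ?_⟩
  have : (f.quotKerEquivOfSurjective hf).symm (f x) = Submodule.Quotient.mk x := by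
    rw [LinearEquiv.symm_apply_eq]; rfl
  rw [LinearMap.comp_apply, LinearEquiv.coe_coe, this]
  rfl

/-- The idempotent `e` extends to an endomorphism `v` of `P`, which induces `φ` on `M`. By Fitting,
`φ` is nilpotent or surjective. If nilpotent, a power of `v` lands in `ker f`, so `e` extends to `P
→ ker f` and superfluity of `ker f` forces `e = 0`. If surjective, superfluity makes `v` surjective,
hence injective, so `e` is an injective idempotent. -/
theorem IsEssentialEpi.idempotent_ker_trivial {P : Type u} [AddCommGroup P] [Module R P]
    [IsNoetherian R P] {M : ModuleCat.{u} R} [IsArtinian R M] [IsNoetherian R M]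
    (hM : Indecomposable M) {f : P →ₗ[R] M} (hf : IsEssentialEpi f)
    (hext : ∀ a : LinearMap.ker f →ₗ[R] P, ∃ b : P →ₗ[R] P, ∀ x : LinearMap.ker f, b x = a x)
    (e : LinearMap.ker f →ₗ[R] LinearMap.ker f) (he : ∀ x, e (e x) = e x) :
    e = 0 ∨ e = LinearMap.id := by
  obtain ⟨v, hv⟩ := hext ((LinearMap.ker f).subtype ∘ₗ e)
  replace hv : ∀ x : LinearMap.ker f, v x = e x := hv
  obtain ⟨φ, hφ⟩ := exists_linearMap_factor hf.surjective (f ∘ₗ v) (fun x hx => by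
    have := hv ⟨x, hx⟩
    simp only at this
    rw [LinearMap.comp_apply, this]
    exact (e ⟨x, hx⟩).2)
  replace hφ : ∀ x, φ (f x) = f (v x) := hφ
  rcases hM.pow_eq_zero_or_surjective φ with ⟨n, hn⟩ | hs
  · left
    have hpow : ∀ (m : ℕ) (x : P), (φ ^ m) (f x) = f ((v ^ m) x) := by
      intro m
      induction m with
      | zero => simp
      | succ m ih => intro x; rw [pow_succ, pow_succ, Module.End.mul_apply, hφ, ih]; rfl
    have hvpow : ∀ (m : ℕ) (x : LinearMap.ker f), (v ^ (m + 1)) x = e x := by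
      intro m
      induction m with
      | zero => simpa using hv
      | succ m ih => intro x; rw [pow_succ, Module.End.mul_apply, hv, ih, he]
    let c : P →ₗ[R] LinearMap.ker f := (v ^ (n + 1)).codRestrict _ (fun x => by
      rw [LinearMap.mem_ker, ← hpow, hn]; rfl)
    have hc : ∀ x : LinearMap.ker f, c x = e x := fun x => Subtype.ext (hvpow n x)
    have htop : LinearMap.ker (e ∘ₗ c) = ⊤ := by
      refine hf.superfluous _ (eq_top_iff.mpr fun p _ => ?_)
      -- Since `c` restricts to `e` on `ker f`, the map `e ∘ c` is idempotent as an endomorphism of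
      -- `P`, with image inside `ker f`.
      rw [← sub_add_cancel p (e (c p) : P)]
      refine Submodule.add_mem_sup ?_ (e (c p)).2
      rw [LinearMap.mem_ker, map_sub, sub_eq_zero]
      simp [hc, he]
    ext x
    have : (e ∘ₗ c) x = 0 := by
      rw [← LinearMap.mem_ker, htop]; trivial
    rw [LinearMap.comp_apply, hc, he] at this
    simp [this]
  · right
    have htop : LinearMap.range v = ⊤ := by
      refine hf.superfluous _ (eq_top_iff.mpr fun p _ => ?_)
      obtain ⟨m, hm⟩ := hs (f p)
      obtain ⟨q, rfl⟩ := hf.surjective m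
      rw [← add_sub_cancel (v q) p]
      refine Submodule.add_mem_sup ⟨q, rfl⟩ ?_
      rw [LinearMap.mem_ker, map_sub, ← hφ, hm, sub_self]
    have hinj := IsNoetherian.injective_of_surjective_endomorphism v
      (LinearMap.range_eq_top.mp htop)
    ext x
    refine hinj ?_
    rw [hv, he, LinearMap.id_apply, hv]

end Indecomposable

/-! ### Projective covers over Artinian rings, and Ext into projectives. -/

section ProjectiveCover

variable {R : Type u} [Ring R]

/-- A minimal projective submodule `N` of `R^n` mapping onto `M` is a projective cover. If `L ≤ N`
still maps onto `M`, a minimal such `L₀ ≤ L` is a retract of `N`, hence projective, hence equal to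
`N`. -/
theorem exists_isEssentialEpi [IsArtinianRing R] (M : Type u) [AddCommGroup M] [Module R M]
    [Module.Finite R M] : ∃ (P : ModuleCat.{u} R) (f : P →ₗ[R] M),
      Module.Finite R P ∧ Module.Projective R P ∧ IsEssentialEpi f := by
  obtain ⟨n, f, hf⟩ := Module.Finite.exists_fin' R M
  obtain ⟨N, ⟨hNproj, hNtop⟩, hNmin⟩ := IsArtinian.set_has_minimal
    {N : Submodule R (Fin n → R) | Module.Projective R N ∧ N.map f = ⊤}
    ⟨⊤, Module.Projective.of_equiv Submodule.topEquiv.symm, by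
      rwa [Submodule.map_top, LinearMap.range_eq_top]⟩
  refine ⟨.of R N, f ∘ₗ N.subtype, inferInstance, hNproj, ⟨?_, fun L hL => ?_⟩⟩
  · rw [← LinearMap.range_eq_top, LinearMap.range_comp, Submodule.range_subtype, hNtop]
  have hLtop : (L.map N.subtype).map f = ⊤ := by
    rw [← Submodule.map_comp, eq_top_iff, ← hNtop]
    rintro _ ⟨x, hx, rfl⟩
    have hmem : (⟨x, hx⟩ : N) ∈ L ⊔ LinearMap.ker (f ∘ₗ N.subtype) := by rw [hL]; trivial
    obtain ⟨y, hy, z, hz, hyz⟩ := Submodule.mem_sup.mp hmem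
    refine ⟨y, hy, ?_⟩
    have h2 := congrArg (f ∘ₗ N.subtype) hyz
    rw [map_add, LinearMap.mem_ker.mp hz, add_zero] at h2
    exact h2
  obtain ⟨L₀, ⟨hL₀le, hL₀top⟩, hL₀min⟩ := IsArtinian.set_has_minimal
    {K : Submodule R (Fin n → R) | K ≤ L.map N.subtype ∧ K.map f = ⊤} ⟨_, le_rfl, hLtop⟩
  have hL₀N : L₀ ≤ N := hL₀le.trans (Submodule.map_subtype_le _ _)
  have hsurj : Function.Surjective (f ∘ₗ L₀.subtype) := by
    rw [← LinearMap.range_eq_top, LinearMap.range_comp, Submodule.range_subtype, hL₀top]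
  obtain ⟨h, hh⟩ := Module.projective_lifting_property (f ∘ₗ L₀.subtype) (f ∘ₗ N.subtype) hsurj
  have hh' : ∀ x : N, f (h x) = f x := fun x => congr($hh x)
  let i : L₀ →ₗ[R] N := Submodule.inclusion hL₀N
  -- The image of `L₀ → N → L₀` still maps onto `M`, so it is all of `L₀` by minimality.
  have hs : Function.Surjective (h ∘ₗ i) := by
    have hle : (LinearMap.range (h ∘ₗ i)).map L₀.subtype ≤ L₀ := Submodule.map_subtype_le _ _
    have htop : ((LinearMap.range (h ∘ₗ i)).map L₀.subtype).map f = ⊤ := by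
      rw [eq_top_iff, ← hL₀top]
      rintro _ ⟨x, hx, rfl⟩
      exact ⟨h (i ⟨x, hx⟩), ⟨h (i ⟨x, hx⟩), ⟨⟨x, hx⟩, rfl⟩, rfl⟩, hh' _⟩
    have heq := eq_of_le_of_not_lt hle (hL₀min _ ⟨hle.trans hL₀le, htop⟩)
    intro y
    have hy : (y : Fin n → R) ∈ (LinearMap.range (h ∘ₗ i)).map L₀.subtype := by
      rw [heq]; exact y.2
    obtain ⟨z, ⟨w, hw⟩, hz⟩ := hy
    exact ⟨w, hw.trans (Subtype.ext hz)⟩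
  let ε := LinearEquiv.ofBijective (h ∘ₗ i)
    ⟨IsNoetherian.injective_of_surjective_endomorphism _ hs, hs⟩
  have hproj : Module.Projective R L₀ := Module.Projective.of_split i (ε.symm.toLinearMap ∘ₗ h)
    (LinearMap.ext fun x => ε.symm_apply_apply x)
  have heq := eq_of_le_of_not_lt hL₀N (hNmin L₀ ⟨hproj, hL₀top⟩)
  rw [eq_top_iff]
  intro x _
  obtain ⟨y, hy, hyx⟩ := hL₀le (heq ▸ x.2 : (x : Fin n → R) ∈ L₀)
  rwa [← show y = x from Subtype.ext hyx]

theorem exists_dualBasis (P : Type u) [AddCommGroup P] [Module R P] [Module.Finite R P]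
    [Module.Projective R P] : ∃ (n : ℕ) (x : Fin n → P) (φ : Fin n → P →ₗ[R] R),
      ∀ p, ∑ i, φ i p • x i = p := by
  obtain ⟨n, f, g, -, -, hfg⟩ := Module.Finite.exists_comp_eq_id_of_projective R P
  refine ⟨n, fun i => f (Pi.single i 1), fun i => LinearMap.proj i ∘ₗ g, fun p => ?_⟩
  have h : f (g p) = p := congr($hfg p)
  conv_rhs => rw [← h, ← Finset.univ_sum_single (g p), map_sum]
  refine Finset.sum_congr rfl fun i _ => ?_
  rw [← map_smul, ← Pi.single_smul]
  simp

theorem Ext_subsingleton_of_finite_projective (M : ModuleCat.{u} R) (P : ModuleCat.{u} R)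
    [Module.Finite R P] [Module.Projective R P] (i : ℕ)
    [Subsingleton (Abelian.Ext.{u} M (ModuleCat.of R R) i)] :
    Subsingleton (Abelian.Ext.{u} M P i) := by
  obtain ⟨n, x, φ, h⟩ := exists_dualBasis (R := R) P
  refine subsingleton_of_forall_eq 0 fun y => ?_
  let a (j : Fin n) : P ⟶ ModuleCat.of R R := ModuleCat.ofHom (φ j)
  let b (j : Fin n) : ModuleCat.of R R ⟶ P := ModuleCat.ofHom (LinearMap.toSpanSingleton R P (x j))
  -- The dual basis writes the identity of `P` as a sum of maps through `R`, where Ext vanishes.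
  have hid : 𝟙 P = ∑ j, a j ≫ b j := by
    ext p
    simp [a, b, h]
  rw [← Abelian.Ext.comp_mk₀_id y, hid, Abelian.Ext.mk₀_sum, Abelian.Ext.comp_sum]
  refine Finset.sum_eq_zero fun j _ => ?_
  rw [← Abelian.Ext.mk₀_comp_mk₀, ← Abelian.Ext.comp_assoc_of_second_deg_zero,
    Subsingleton.elim (y.comp (Abelian.Ext.mk₀ (a j)) (add_zero i)) 0, Abelian.Ext.zero_comp]

end ProjectiveCover

/-! ### Duality for projectives and the transpose of a syzygy. -/

section Dual

variable {R : Type u} [Ring R]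

theorem dual_projective (P : Type u) [AddCommGroup P] [Module R P] [Module.Finite R P]
    [Module.Projective R P] : Module.Projective Rᵐᵒᵖ (P →ₗ[R] R) := by
  obtain ⟨n, x, φ, h⟩ := exists_dualBasis (R := R) P
  let i : (P →ₗ[R] R) →ₗ[Rᵐᵒᵖ] (Fin n → Rᵐᵒᵖ) :=
    { toFun := fun ψ j => MulOpposite.op (ψ (x j))
      map_add' := fun _ _ => rfl
      map_smul' := fun _ _ => rfl }
  refine Module.Projective.of_split i (Fintype.linearCombination Rᵐᵒᵖ φ) ?_
  ext ψ p
  conv_rhs => rw [LinearMap.id_apply, ← h p]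
  simp [i, Fintype.linearCombination_apply, LinearMap.sum_apply]

theorem eq_zero_of_forall_dual_eq_zero {P : Type u} [AddCommGroup P] [Module R P]
    [Module.Finite R P] [Module.Projective R P] {p : P} (hp : ∀ φ : P →ₗ[R] R, φ p = 0) :
    p = 0 := by
  obtain ⟨n, x, φ, h⟩ := exists_dualBasis (R := R) P
  rw [← h p]
  simp [hp]

/-- Surjectivity half of the reflexivity of `P`; `eq_zero_of_forall_dual_eq_zero` is the injectivity
half. -/
theorem exists_eq_eval {P : Type u} [AddCommGroup P] [Module R P] [Module.Finite R P]
    [Module.Projective R P] (ψ : (P →ₗ[R] R) →ₗ[Rᵐᵒᵖ] R) : ∃ p, ∀ φ, ψ φ = φ p := by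
  obtain ⟨n, x, φ, h⟩ := exists_dualBasis (R := R) P
  refine ⟨∑ j, ψ (φ j) • x j, fun χ => ?_⟩
  have : χ = ∑ j, MulOpposite.op (χ (x j)) • φ j := by
    ext p
    conv_lhs => rw [← h p]
    simp [LinearMap.sum_apply]
  conv_lhs => rw [this]
  simp

/-- Writing `Tr` for the cokernels of the dual maps, `hext` makes `0 → Tr g → P₂^* → Tr d → 0` exact
with projective middle term. Degrees at least 2 follow by shifting. In degree 1, a map `Tr g → R` is
evaluation at some `p` in `P₁` by reflexivity; vanishing on the range of `g^*` gives `g p = 0`, so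
`p = d q`, and evaluation at `q` is the required extension to `P₂^*`. -/
theorem transpose_syzygy {P₂ P₁ P₀ : Type u} [AddCommGroup P₂] [Module R P₂] [Module.Finite R P₂]
    [Module.Projective R P₂] [AddCommGroup P₁] [Module R P₁] [Module.Finite R P₁]
    [Module.Projective R P₁] [AddCommGroup P₀] [Module R P₀] [Module.Finite R P₀]
    [Module.Projective R P₀] (d : P₂ →ₗ[R] P₁) (g : P₁ →ₗ[R] P₀)
    (hdg : LinearMap.range d = LinearMap.ker g)
    (hext : ∀ ψ : P₁ →ₗ[R] R, ψ ∘ₗ d = 0 → ∃ χ : P₀ →ₗ[R] R, ψ = χ ∘ₗ g)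
    (hT : ∀ i : ℕ, 1 ≤ i → Subsingleton (Abelian.Ext.{u}
      (ModuleCat.of Rᵐᵒᵖ ((P₁ →ₗ[R] R) ⧸ LinearMap.range (dualMapOp g)))
        (ModuleCat.of Rᵐᵒᵖ R) i)) (i : ℕ) (hi : 1 ≤ i) :
    Subsingleton (Abelian.Ext.{u}
      (ModuleCat.of Rᵐᵒᵖ ((P₂ →ₗ[R] R) ⧸ LinearMap.range (dualMapOp d)))
        (ModuleCat.of Rᵐᵒᵖ R) i) := by
  have hgd : ∀ x, g (d x) = 0 := fun x => by
    rw [← LinearMap.mem_ker, ← hdg]; exact ⟨x, rfl⟩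
  let j : ((P₁ →ₗ[R] R) ⧸ LinearMap.range (dualMapOp g)) →ₗ[Rᵐᵒᵖ] (P₂ →ₗ[R] R) :=
    Submodule.liftQ _ (dualMapOp d) (by
      rintro _ ⟨χ, rfl⟩
      ext x
      exact (congrArg χ (hgd x)).trans (map_zero χ))
  have hj : Function.Injective j := by
    rw [← LinearMap.ker_eq_bot, LinearMap.ker_eq_bot']
    intro m hm
    obtain ⟨ψ, rfl⟩ := Submodule.Quotient.mk_surjective _ m
    obtain ⟨χ, hχ⟩ := hext ψ hm
    exact (Submodule.Quotient.mk_eq_zero _).mpr ⟨χ, hχ.symm⟩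
  have hjrange : LinearMap.range j = LinearMap.range (dualMapOp d) := Submodule.range_liftQ _ _ _
  have hex : Function.Exact j (LinearMap.range (dualMapOp d)).mkQ := by
    rw [LinearMap.exact_iff, Submodule.ker_mkQ, hjrange]
  let S := ModuleCat.shortComplexOfCompEqZero j (LinearMap.range (dualMapOp d)).mkQ
    hex.linearMap_comp_eq_zero
  have hS : S.ShortExact := ModuleCat.shortComplex_shortExact S hex hj
    (Submodule.mkQ_surjective _)
  have : Module.Projective Rᵐᵒᵖ (P₂ →ₗ[R] R) := dual_projective P₂
  have : Projective S.X₂ := (IsProjective.iff_projective (P₂ →ₗ[R] R)).mp this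
  obtain ⟨i, rfl⟩ := Nat.exists_eq_add_of_le' hi
  cases i with
  | succ n =>
    have : Subsingleton (Abelian.Ext.{u} S.X₁ (ModuleCat.of Rᵐᵒᵖ R) (n + 1)) := hT _ (by omega)
    exact Ext_subsingleton_X₃ hS _ n
  | zero =>
    refine Ext_one_subsingleton_of_exists_extension hS fun a => ?_
    obtain ⟨p, hp⟩ := exists_eq_eval (a.hom ∘ₗ (LinearMap.range (dualMapOp g)).mkQ)
    have hgp : g p = 0 := eq_zero_of_forall_dual_eq_zero fun χ => by
      refine (hp (dualMapOp g χ)).symm.trans ?_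
      have : (LinearMap.range (dualMapOp g)).mkQ (dualMapOp g χ) = 0 :=
        (Submodule.Quotient.mk_eq_zero _).mpr ⟨χ, rfl⟩
      rw [LinearMap.comp_apply, this]
      exact map_zero a.hom
    obtain ⟨q, rfl⟩ : p ∈ LinearMap.range d := hdg ▸ hgp
    let b : (P₂ →ₗ[R] R) →ₗ[Rᵐᵒᵖ] R :=
      { toFun := fun φ => φ q
        map_add' := fun _ _ => rfl
        map_smul' := fun _ _ => rfl }
    refine ⟨ModuleCat.ofHom b, ModuleCat.hom_ext (LinearMap.ext fun m => ?_)⟩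
    obtain ⟨ψ, rfl⟩ := Submodule.Quotient.mk_surjective _ m
    exact (hp ψ).symm

end Dual

/-! ### Syzygies inherit the hypotheses, and the pigeonhole argument. -/

section Syzygy

variable {R : Type u} [Ring R]

theorem IsInC.ker [IsNoetherianRing R] {M : ModuleCat.{u} R} (hM : IsInC M) {P : ModuleCat.{u} R}
    [Module.Finite R P] [Module.Projective R P] {f : P →ₗ[R] M} (hf : Function.Surjective f) :
    IsInC (ModuleCat.of R (LinearMap.ker f)) := by
  refine ⟨Module.Finite.of_injective _ (LinearMap.ker f).injective_subtype, fun i hi => ?_⟩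
  have hS := LinearMap.shortExact_shortComplexKer hf
  have : Projective f.shortComplexKer.X₂ := (IsProjective.iff_projective P).mp inferInstance
  obtain ⟨n, rfl⟩ := Nat.exists_eq_add_of_le' hi
  have : Subsingleton (Abelian.Ext.{u} f.shortComplexKer.X₃ (ModuleCat.of R R) (n + 2)) :=
    hM.ext_eq_zero _ (by omega)
  exact Ext_subsingleton_X₁ hS _ n

theorem IsGorensteinProjective.isInC {M : ModuleCat.{u} R} (hM : IsGorensteinProjective M) :
    IsInC M := ⟨hM.finite, hM.ext_eq_zero⟩

theorem IsInC.exists_syzygy [IsArtinianRing R] {M : ModuleCat.{u} R} (hM : IsInC M) :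
    ∃ (P : ModuleCat.{u} R) (f : P →ₗ[R] M), Module.Finite R P ∧ Module.Projective R P ∧
      IsEssentialEpi f ∧ IsInC (ModuleCat.of R (LinearMap.ker f)) := by
  have := hM.finite
  obtain ⟨P, f, h1, h2, h3⟩ := exists_isEssentialEpi (R := R) M
  exact ⟨P, f, h1, h2, h3, hM.ker h3.surjective⟩

theorem IsGorensteinProjective.exists_syzygy [IsArtinianRing R] {M : ModuleCat.{u} R}
    (hM : IsGorensteinProjective M) :
    ∃ (P : ModuleCat.{u} R) (f : P →ₗ[R] M), Module.Finite R P ∧ Module.Projective R P ∧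
      IsEssentialEpi f ∧ IsGorensteinProjective (ModuleCat.of R (LinearMap.ker f)) := by
  obtain ⟨T, ⟨P₁, P₀, g, f, hgf, ⟨eT⟩⟩, hT⟩ := hM.ext_transpose_eq_zero
  obtain ⟨_, _, _, _, hex, hf, hg⟩ := hgf
  have hker := hM.isInC.ker hf.surjective
  obtain ⟨P₂, d', _, _, hd'⟩ := exists_isEssentialEpi (R := R) (LinearMap.ker g)
  let d : P₂ →ₗ[R] P₁ := (LinearMap.ker g).subtype ∘ₗ d'
  have hd : LinearMap.range d = LinearMap.ker g := by
    rw [LinearMap.range_comp, LinearMap.range_eq_top.mpr hd'.surjective, Submodule.map_top,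
      Submodule.range_subtype]
  have hfg : ∀ x, f (g x) = 0 := fun x => by
    rw [← LinearMap.mem_ker, ← hex]; exact ⟨x, rfl⟩
  let g' : P₁ →ₗ[R] LinearMap.ker f := g.codRestrict _ hfg
  have hg'surj : Function.Surjective g' := fun y => by
    obtain ⟨x, hx⟩ : (y : P₀) ∈ LinearMap.range g := by rw [hex]; exact y.2
    exact ⟨x, Subtype.ext hx⟩
  have hg'ker : LinearMap.ker g' = LinearMap.ker g := LinearMap.ker_codRestrict _ _ _
  -- Shifting the resolution by one step, `P₂ → P₁ → ker f` is a minimal presentation of the syzygy.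
  refine ⟨P₀, f, ‹_›, ‹_›, hf, hker.finite, hker.ext_eq_zero,
    .of Rᵐᵒᵖ ((P₂ →ₗ[R] R) ⧸ LinearMap.range (dualMapOp d)),
    ⟨P₂, P₁, d, g', ⟨‹_›, ‹_›, ‹_›, ‹_›, ?_, ⟨hg'surj, ?_⟩, ⟨?_, ?_⟩⟩, ⟨LinearEquiv.refl _ _⟩⟩, ?_⟩
  · rw [hd, hg'ker]
  · intro N hN
    refine hg.superfluous N ?_
    rwa [LinearMap.ker_rangeRestrict, ← hg'ker]
  · exact LinearMap.surjective_rangeRestrict d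
  · intro N hN
    refine hd'.superfluous N ?_
    rwa [LinearMap.ker_rangeRestrict, LinearMap.ker_comp_of_ker_eq_bot _
      (Submodule.ker_subtype _)] at hN
  · refine transpose_syzygy d g hd (fun ψ hψ => ?_) (fun i hi => ?_)
    -- A functional killing the range of `d` descends to `ker f`, then extends to `P₀` because
    -- `Ext^1(M, R) = 0`.
    · obtain ⟨a, ha⟩ := exists_linearMap_factor hg'surj ψ (fun x hx => by
        obtain ⟨y, rfl⟩ : x ∈ LinearMap.range d := hd ▸ hg'ker ▸ hx
        exact congr($hψ y))
      have : Subsingleton (Abelian.Ext.{u} f.shortComplexKer.X₃ (ModuleCat.of R R) 1) :=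
        hM.ext_eq_zero 1 le_rfl
      obtain ⟨b, hb⟩ := exists_extension_of_Ext_subsingleton
        (LinearMap.shortExact_shortComplexKer hf.surjective) (ModuleCat.ofHom a)
      refine ⟨b.hom, LinearMap.ext fun x => ?_⟩
      rw [← ha x]
      exact congr($hb (g' x)).symm
    · have := hT i hi
      exact Ext_subsingleton_of_iso eT.toModuleIso _ i

theorem ker_isSelfOrthogonal_indecomposable_not_projective [IsArtinianRing R]
    {M : ModuleCat.{u} R} (hC : IsInC M) (hM : IsSelfOrthogonal M) (hind : Indecomposable M)
    (hproj : ¬ Module.Projective R M) {P : ModuleCat.{u} R} [Module.Finite R P]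
    [Module.Projective R P] {f : P →ₗ[R] M} (hf : IsEssentialEpi f) :
    IsSelfOrthogonal (ModuleCat.of R (LinearMap.ker f)) ∧
      Indecomposable (ModuleCat.of R (LinearMap.ker f)) ∧
      ¬ Module.Projective R (LinearMap.ker f) := by
  have := hC.finite
  have hS := LinearMap.shortExact_shortComplexKer hf.surjective
  have hP2 : Projective f.shortComplexKer.X₂ := (IsProjective.iff_projective P).mp inferInstance
  have hextM : ∀ (Q : ModuleCat.{u} R) [Module.Finite R Q] [Module.Projective R Q] (i : ℕ),
      1 ≤ i → Subsingleton (Abelian.Ext.{u} f.shortComplexKer.X₃ Q i) := fun Q _ _ i hi => by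
    have := hC.ext_eq_zero i hi
    exact Ext_subsingleton_of_finite_projective M Q i
  have hnp : ¬ Module.Projective R (LinearMap.ker f) := fun h => hproj <| by
    have : Module.Finite R (LinearMap.ker f) := inferInstance
    have := hextM (.of R (LinearMap.ker f)) 1 le_rfl
    obtain ⟨s, hs⟩ := exists_section_of_Ext_subsingleton hS
    exact Module.Projective.of_split s.hom f (LinearMap.ext fun x => congr($hs x))
  refine ⟨fun i hi => ?_, indecomposable_of_idempotents (fun h0 => hnp ?_) (fun e he => ?_), hnp⟩
  -- `Ext^(n+2)(M, ΩM)` sits between `Ext^(n+1)(M, M)` and `Ext^(n+2)(M, P)`, both zero; it then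
  -- shifts to `Ext^(n+1)(ΩM, ΩM)`.
  · obtain ⟨n, rfl⟩ := Nat.exists_eq_add_of_le' hi
    have h1 : Subsingleton (Abelian.Ext.{u} f.shortComplexKer.X₃ f.shortComplexKer.X₃ (n + 1)) :=
      hM _ hi
    have h2 : Subsingleton (Abelian.Ext.{u} f.shortComplexKer.X₃ f.shortComplexKer.X₂ (n + 2)) :=
      hextM P _ (by omega)
    have h3 := Ext_subsingleton_right_X₁ hS f.shortComplexKer.X₃ (n + 1)
    exact Ext_subsingleton_X₁ hS _ n
  · have : Subsingleton (LinearMap.ker f) := ModuleCat.subsingleton_of_isZero h0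
    infer_instance
  · refine hf.idempotent_ker_trivial hind (fun a => ?_) e he
    have := hextM P 1 le_rfl
    obtain ⟨b, hb⟩ := exists_extension_of_Ext_subsingleton hS (Y := P) (ModuleCat.ofHom a)
    exact ⟨b.hom, fun x => congr($hb x)⟩

/-- Both classes enter only through closure under the syzygy of some projective cover and
containment in `𝒞`, so one argument serves for both. -/
theorem projective_of_finitelyManyIsoclasses [IsArtinianRing R] (D : ModuleCat.{u} R → Prop)
    (hDC : ∀ M, D M → IsInC M)
    (hD : ∀ M, D M → ∃ (P : ModuleCat.{u} R) (f : P →ₗ[R] M), Module.Finite R P ∧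
      Module.Projective R P ∧ IsEssentialEpi f ∧ D (ModuleCat.of R (LinearMap.ker f)))
    (hfin : FinitelyManyIsoclasses
      fun N : ModuleCat.{u} R => D N ∧ IsSelfOrthogonal N ∧ Indecomposable N)
    (M : ModuleCat.{u} R) (hM : D M) (hMso : IsSelfOrthogonal M) (hMind : Indecomposable M) :
    Module.Projective R M := by
  by_contra hMproj
  let Q (N : ModuleCat.{u} R) : Prop :=
    (D N ∧ IsSelfOrthogonal N ∧ Indecomposable N) ∧ ¬ Module.Projective R N
  have step : ∀ N : {N // Q N}, ∃ (K : {N // Q N}) (P : ModuleCat.{u} R) (f : P →ₗ[R] N.1),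
      Module.Projective R P ∧ Function.Surjective f ∧
        K.1 = ModuleCat.of R (LinearMap.ker f) := by
    rintro ⟨N, ⟨h1, h2, h3⟩, h4⟩
    obtain ⟨P, f, hP, hP', hf, hK⟩ := hD N h1
    obtain ⟨k1, k2, k3⟩ :=
      ker_isSelfOrthogonal_indecomposable_not_projective (hDC N h1) h2 h3 h4 hf
    exact ⟨⟨_, ⟨hK, k1, k2⟩, k3⟩, P, f, hP', hf.surjective, rfl⟩
  choose Ω hΩ using step
  let X (n : ℕ) : {N // Q N} := Ω^[n] ⟨M, ⟨hM, hMso, hMind⟩, hMproj⟩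
  have hX (n : ℕ) : ∃ (P : ModuleCat.{u} R) (f : P →ₗ[R] (X n).1), Module.Projective R P ∧
      Function.Surjective f ∧ (X (n + 1)).1 = ModuleCat.of R (LinearMap.ker f) := by
    simp only [X, Function.iterate_succ_apply']
    exact hΩ _
  have shift (Y : ModuleCat.{u} R) (n : ℕ)
      (hY : ∀ m, Subsingleton (Abelian.Ext.{u} (X n).1 Y (m + 1))) (d : ℕ) :
      ∀ m, Subsingleton (Abelian.Ext.{u} (X (n + d)).1 Y (m + 1)) := by
    induction d with
    | zero => exact hY
    | succ d ih =>
      intro m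
      obtain ⟨P, f, hP, hf, hK⟩ := hX (n + d)
      rw [← add_assoc, hK]
      have : Projective f.shortComplexKer.X₂ := (IsProjective.iff_projective P).mp hP
      have : Subsingleton (Abelian.Ext.{u} f.shortComplexKer.X₃ Y (m + 2)) := ih (m + 1)
      exact Ext_subsingleton_X₁ (LinearMap.shortExact_shortComplexKer hf) Y m
  have key (i j : ℕ) (hij : i < j) (e : (X i).1 ≅ (X j).1) : False := by
    obtain ⟨d, rfl⟩ := Nat.exists_eq_add_of_lt hij
    -- Here `j = i + d + 1`, so `X (i + d)` is the module whose syzygy is `X j`; the last argument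
    -- `0` selects `Ext^1`.
    have h1 := shift (X i).1 i (fun m => (X i).2.1.2.1 _ (by omega)) d 0
    have h2 := Ext_subsingleton_of_iso_right (X (i + d)).1 e 1
    have hnp := (X (i + d)).2.2
    obtain ⟨P, f, hP, hf, hK⟩ := hX (i + d)
    rw [hK] at h2
    have : Subsingleton (Abelian.Ext.{u} f.shortComplexKer.X₃ f.shortComplexKer.X₁ 1) := h2
    obtain ⟨s, hs⟩ := exists_section_of_Ext_subsingleton
      (LinearMap.shortExact_shortComplexKer hf)
    exact hnp (Module.Projective.of_split s.hom f (LinearMap.ext fun x => congr($hs x)))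
  have := hfin.to_subtype
  obtain ⟨i, j, hij, h⟩ := Finite.exists_ne_map_eq_of_infinite (fun n : ℕ =>
    (⟨_, ⟨(X n).1, (X n).2.1, rfl⟩⟩ : ((fun M : ModuleCat.{u} R =>
      Quotient.mk (isIsomorphicSetoid (ModuleCat.{u} R)) M) ''
        {N | D N ∧ IsSelfOrthogonal N ∧ Indecomposable N})))
  obtain ⟨e⟩ : Nonempty ((X i).1 ≅ (X j).1) := Quotient.exact (congrArg Subtype.val h)
  rcases lt_or_gt_of_ne hij with hlt | hlt
  · exact key i j hlt e
  · exact key j i hlt e.symm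

end Syzygy

theorem proposition3p5 {k : Type*} [CommRing k] [IsArtinianRing k]
    {Λ : Type u} [Ring Λ] [Algebra k Λ] [Module.Finite k Λ] :
    (FinitelyManyIsoclasses (fun N : ModuleCat.{u} Λ =>
        IsGorensteinProjective N ∧ IsSelfOrthogonal N ∧ Indecomposable N) →
      ∀ M : ModuleCat.{u} Λ,
        IsGorensteinProjective M → IsSelfOrthogonal M → Indecomposable M →
          Module.Projective Λ M) ∧
    (FinitelyManyIsoclasses (fun N : ModuleCat.{u} Λ =>
        IsInC N ∧ IsSelfOrthogonal N ∧ Indecomposable N) →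
      ∀ M : ModuleCat.{u} Λ,
        IsInC M → IsSelfOrthogonal M → Indecomposable M →
          Module.Projective Λ M) := by
  have : IsArtinianRing Λ := IsArtinianRing.of_finite k Λ
  exact ⟨projective_of_finitelyManyIsoclasses _ (fun _ h => h.isInC) (fun _ h => h.exists_syzygy),
    projective_of_finitelyManyIsoclasses _ (fun _ h => h) (fun _ h => h.exists_syzygy)⟩
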